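/- Let $X$ be a Banach space and $U$ a normed space (over $\mathbb R$; complex spaces are covered by restriction of scalars), $\mathcal U=L^\infty([0,\infty),U)$ with the essential supremum norm, $D=\{d\in U:\|d\|\le 1\}$, $\mathcal D=\{d\in\mathcal U:\|d\|_{\mathcal U}\le 1\}$, $B_C=\{x\in X:\|x\|<C\}$, $B_{C,U}=\{u\in U:\|u\|<C\}$. Let $\mathcal K_\infty$ be the set of continuous, strictly increasing, unbounded $\eta:[0,\infty)\to[0,\infty)$ with $\eta(0)=0$, and $\operatorname{Lip}_1$ the set of $1$-Lipschitz functions $[0,\infty)\to[0,\infty)$. Let $A$ generate a $C_0$-semigroup $(T(t))_{t\ge 0}$ on $X$ and let $f:X\times U\to X$ be such that $s\mapsto f(x,u(s))$ is strongly measurable for all $x\in X$, $u\in\mathcal U$. A mild solution on $[0,\tau]$ of $\dot x(t)=Ax(t)+g(t,x(t))$, $x(0)=x_0$, is an $x\in C([0,\tau],X)$ such that for every $t\in[0,\tau]$ the function $s\mapsto T(t-s)g(s,x(s))$ is integrable on $[0,t]$ and $x(t)=T(t)x_0+\int_0^t T(t-s)g(s,x(s))\,ds$. Consider $$\Sigma:\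 \dot x(t)=Ax(t)+f(x(t),u(t)),\qquad u\in\mathcal U .$$ Suppose that $\Sigma$ is well posed and forward complete: for all $x_0\in X$, $u\in\mathcal U$ there is a mild solution $\phi(\cdot,x_0,u)$ on $[0,\infty)$, and on each $[0,\tau]$ it is the only mild solution. Suppose also that $\Sigma$ has bounded reachability sets: for all $C>0$, $\tau\ge0$, $\sup\{\|\phi(t,x,u)\|:\|x\|<C,\ \|u\|_{\mathcal U}<C,\ 0\le t<\tau\}<\infty$. For $\eta\in\mathcal K_\infty$ let $\mathcal U_x^\eta=\{v\in\mathcal U:\|v(\theta)\|\le\eta(\|\phi(\theta,x,v)\|)\text{ for a.e. }\theta\ge0\}$, and let $$\Sigma_\eta:\ \dot x(t)=Ax(t)+f\big(x(t),d(t)\eta(\|x(t)\|)\big),\qquad d\in\mathcal D .$$ For $\eta\in\mathcal K_\infty$ consider the condition $(\mathrm{L}_\eta)$ for each $C>0$ there is $L_C>0$ such that $\|f(x_1,d\,\eta(\|x_1\|))-f(x_2,d\,\eta(\|x_2\|))\|\le L_C\|x_1-x_2\|$ for all $x_1,x_2\in B_C$, $d\in D$. Consider the following statements. 1. For each $C>0$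 there is $L_C>0$ such that $\|f(x_1,u_1)-f(x_2,u_2)\|\le L_C(\|x_1-x_2\|+\|u_1-u_2\|)$ for all $x_1,x_2\in B_C$, $u_1,u_2\in B_{C,U}$. 2. $(\mathrm{L}_\eta)$ holds for every $\eta\in\mathcal K_\infty\cap\operatorname{Lip}_1$. 3. There is $\eta\in\mathcal K_\infty\cap\operatorname{Lip}_1$ such that $(\mathrm{L}_\eta)$ holds and $\Sigma$ is robustly forward complete with respect to trajectory-dominated inputs with growth margin $\eta$: for all $C>0$, $\tau\ge0$, $\sup\{\|\phi(t,x,u)\|:\|x\|<C,\ u\in\mathcal U_x^\eta,\ 0\le t<\tau\}<\infty$. 4. There is $\eta\in\mathcal K_\infty\cap\operatorname{Lip}_1$ such that for all $x\in X$, $d\in\mathcal D$ the system $\Sigma_\eta$ has a mild solution $\phi_{\mathrm{CL}}(\cdot,x,d)$ on $[0,\infty)$ with $\phi_{\mathrm{CL}}(0,x,d)=x$, unique on each $[0,\tau]$, and its flow is Lipschitz continuous on compact intervals uniformly in $d\in\mathcal D$: for all $\tau>0$, $C>0$ there is $L>0$ such that $\|\phi_{\mathrm{CL}}(t,x_1,d)-\phi_{\mathrm{CL}}(t,x_2,d)\|\le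 L\|x_1-x_2\|$ for all $x_1,x_2\in B_C$, $d\in\mathcal D$, $t\in[0,\tau)$. 5. The flow of $\Sigma$ is Lipschitz continuous on compact intervals with respect to trajectory-dominated inputs: there is $\eta\in\mathcal K_\infty$ such that for all $\tau>0$, $C>0$ there is $L>0$ such that for all $x_1,x_2\in B_C$ and every $u_1\in\mathcal U_{x_1}^\eta$ there is $u_2\in\mathcal U_{x_2}^\eta$ with $\|\phi(t,x_1,u_1)-\phi(t,x_2,u_2)\|\le L\|x_1-x_2\|$ for all $t\in[0,\tau)$. Then $(1)\Rightarrow(2)\Rightarrow(3)\Rightarrow(4)\Rightarrow(5)$. -/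

import Mathlib

open MeasureTheory Set Filter Topology
open scoped NNReal ENNReal

namespace BRS

/-- Comparison functions of class `K_∞`: continuous, strictly increasing, unbounded functions
`[0, ∞) → [0, ∞)` vanishing at `0`. -/
structure IsClassKInf (η : ℝ≥0 → ℝ≥0) : Prop where
  map_zero : η 0 = 0
  continuous : Continuous η
  strictMono : StrictMono η
  unbounded : ¬ BddAbove (range η)

/-- The class `K_∞ ∩ Lip_1` of globally `1`-Lipschitz comparison functions of class `K_∞`. -/
def IsClassKInfLipOne (η : ℝ≥0 → ℝ≥0) : Prop :=
  IsClassKInf η ∧ LipschitzWith 1 η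

/-- The space `L^∞([0, ∞), U)` of admissible inputs, with the essential supremum norm. -/
abbrev Input (U : Type*) [NormedAddCommGroup U] : Type _ :=
  Lp U ∞ (volume.restrict (Ici (0 : ℝ)))

section

variable {X U : Type*} [NormedAddCommGroup X] [NormedSpace ℝ X]
  [NormedAddCommGroup U] [NormedSpace ℝ U]

/-- `S` is a `C_0`-semigroup of bounded linear operators on `X`
(only the operators `S t` with `t ≥ 0` matter). -/
structure IsC0Semigroup (S : ℝ → X →L[ℝ] X) : Prop where
  map_zero : S 0 = ContinuousLinearMap.id ℝ X
  map_add : ∀ s t : ℝ, 0 ≤ s → 0 ≤ t → S (s + t) = (S s).comp (S t)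
  tendsto_zero : ∀ x : X, Tendsto (fun t : ℝ => S t x) (𝓝[>] 0) (𝓝 x)

/-- The linear operator `A : D(A) → X`, `D(A) ⊆ X`, is the infinitesimal generator of `S`:
`x ∈ D(A)` and `A x = y` if and only if `(S h x - x) / h → y` as `h → 0+`. -/
def IsGenerator (A : X →ₗ.[ℝ] X) (S : ℝ → X →L[ℝ] X) : Prop :=
  ∀ x y : X, (x, y) ∈ A.graph ↔
    Tendsto (fun h : ℝ => h⁻¹ • (S h x - x)) (𝓝[>] 0) (𝓝 y)

/-- `y` is a mild solution on `[0, T]` of `y'(t) = A y(t) + g(t, y(t))`, `y(0) = x₀`, where `A`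
generates `S`: it is continuous, and
`y(t) = S(t) x₀ + ∫₀ᵗ S(t - s) g(s, y(s)) ds` for `t ∈ [0, T]`, with an integrable integrand. -/
def IsMildSolution (S : ℝ → X →L[ℝ] X) (g : ℝ → X → X) (x₀ : X) (T : ℝ) (y : ℝ → X) : Prop :=
  ContinuousOn y (Icc 0 T) ∧
    ∀ t ∈ Icc (0 : ℝ) T,
      IntervalIntegrable (fun s => S (t - s) (g s (y s))) volume 0 t ∧
      y t = S t x₀ + ∫ s in (0 : ℝ)..t, S (t - s) (g s (y s))

/-- `y` is the global mild solution of `y'(t) = A y(t) + g(t, y(t))`, `y(0) = x₀`: it is a mild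
solution on every compact interval `[0, T]`, and there is no other one on any `[0, T]`. -/
def IsUniqueGlobalMildSolution (S : ℝ → X →L[ℝ] X) (g : ℝ → X → X) (x₀ : X) (y : ℝ → X) : Prop :=
  ∀ T : ℝ, 0 < T →
    IsMildSolution S g x₀ T y ∧ ∀ z : ℝ → X, IsMildSolution S g x₀ T z → EqOn z y (Icc 0 T)

/-- The semi-linear evolution equation `x'(t) = A x(t) + f(x(t), u(t))` is well posed and forward
complete, with transition map `φ`: for every initial value `x` and every admissible input `u`,
`t ↦ φ(t, x, u)` is its unique mild solution, and it is defined for all `t ≥ 0`. -/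
def IsFlow (S : ℝ → X →L[ℝ] X) (f : X → U → X) (φ : ℝ → X → Input U → X) : Prop :=
  ∀ (x : X) (u : Input U),
    IsUniqueGlobalMildSolution S (fun s z => f z (u s)) x (fun t => φ t x u)

/-- The closed-loop system `x'(t) = A x(t) + f(x(t), d(t) η(‖x(t)‖))` is well posed and forward
complete for the disturbances `d` in the closed unit ball of `L^∞([0, ∞), U)`, with transition
map `ψ`. -/
def IsClosedLoopFlow (S : ℝ → X →L[ℝ] X) (f : X → U → X) (η : ℝ≥0 → ℝ≥0)
    (ψ : ℝ → X → Input U → X) : Prop :=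
  ∀ (x : X) (d : Input U), ‖d‖ ≤ 1 →
    IsUniqueGlobalMildSolution S (fun s z => f z ((η ‖z‖₊ : ℝ) • d s)) x (fun t => ψ t x d)

/-- Bounded reachability sets of a forward complete system with transition map `φ`. -/
def HasBRS (φ : ℝ → X → Input U → X) : Prop :=
  ∀ C : ℝ, 0 < C → ∀ τ : ℝ, 0 ≤ τ → ∃ M : ℝ,
    ∀ (x : X) (u : Input U) (t : ℝ), ‖x‖ < C → ‖u‖ < C → 0 ≤ t → t < τ → ‖φ t x u‖ ≤ M

/-- The set of trajectory-dominated inputs for the initial value `x` and the growth margin `η`. -/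
def dominatedInputs (φ : ℝ → X → Input U → X) (η : ℝ≥0 → ℝ≥0) (x : X) : Set (Input U) :=
  {v | ∀ᵐ θ ∂(volume.restrict (Ici (0 : ℝ))), ‖v θ‖ ≤ (η ‖φ θ x v‖₊ : ℝ)}

/-- Robust forward completeness with respect to trajectory-dominated inputs, with growth
margin `η`. -/
def IsRFCDominated (φ : ℝ → X → Input U → X) (η : ℝ≥0 → ℝ≥0) : Prop :=
  ∀ C : ℝ, 0 < C → ∀ τ : ℝ, 0 ≤ τ → ∃ M : ℝ,
    ∀ (x : X), ‖x‖ < C → ∀ u ∈ dominatedInputs φ η x, ∀ t : ℝ, 0 ≤ t → t < τ → ‖φ t x u‖ ≤ M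

/-- Joint Lipschitz continuity of `f` on bounded sets. -/
def IsJointlyLipschitzOnBounded (f : X → U → X) : Prop :=
  ∀ C : ℝ, 0 < C → ∃ L : ℝ, 0 < L ∧
    ∀ x₁ x₂ : X, ∀ u₁ u₂ : U, ‖x₁‖ < C → ‖x₂‖ < C → ‖u₁‖ < C → ‖u₂‖ < C →
      ‖f x₁ u₁ - f x₂ u₂‖ ≤ L * (‖x₁ - x₂‖ + ‖u₁ - u₂‖)

/-- The map `x ↦ f(x, d η(‖x‖))` is Lipschitz continuous on bounded balls, uniformly in `d` in the
closed unit ball of `U`. -/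
def IsClosedLoopLipschitz (f : X → U → X) (η : ℝ≥0 → ℝ≥0) : Prop :=
  ∀ C : ℝ, 0 < C → ∃ L : ℝ, 0 < L ∧
    ∀ x₁ x₂ : X, ∀ d : U, ‖x₁‖ < C → ‖x₂‖ < C → ‖d‖ ≤ 1 →
      ‖f x₁ ((η ‖x₁‖₊ : ℝ) • d) - f x₂ ((η ‖x₂‖₊ : ℝ) • d)‖ ≤ L * ‖x₁ - x₂‖

/-- The flow `ψ` is Lipschitz continuous on compact intervals, uniformly in the disturbances `d` in
the closed unit ball of `L^∞([0, ∞), U)`. -/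
def IsFlowLipschitzUniform (ψ : ℝ → X → Input U → X) : Prop :=
  ∀ τ : ℝ, 0 < τ → ∀ C : ℝ, 0 < C → ∃ L : ℝ, 0 < L ∧
    ∀ x₁ x₂ : X, ‖x₁‖ < C → ‖x₂‖ < C → ∀ d : Input U, ‖d‖ ≤ 1 →
      ∀ t : ℝ, 0 ≤ t → t < τ → ‖ψ t x₁ d - ψ t x₂ d‖ ≤ L * ‖x₁ - x₂‖

/-- The flow `φ` is Lipschitz continuous on compact intervals with respect to trajectory-dominated
inputs. -/
def IsFlowLipschitzDominated (φ : ℝ → X → Input U → X) : Prop :=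
  ∃ η : ℝ≥0 → ℝ≥0, IsClassKInf η ∧
    ∀ τ : ℝ, 0 < τ → ∀ C : ℝ, 0 < C → ∃ L : ℝ, 0 < L ∧
      ∀ x₁ x₂ : X, ‖x₁‖ < C → ‖x₂‖ < C →
        ∀ u₁ ∈ dominatedInputs φ η x₁, ∃ u₂ ∈ dominatedInputs φ η x₂,
          ∀ t : ℝ, 0 ≤ t → t < τ → ‖φ t x₁ u₁ - φ t x₂ u₂‖ ≤ L * ‖x₁ - x₂‖

end

end BRS

/-! ### Measurability of composites and Grönwall's inequality -/

namespace BRS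

/-! The substitution `u = d η(‖x‖)` matches the closed loop with the open loop under
trajectory-dominated inputs. `exists_dominatedInput_of_closedLoop` and
`exists_disturbance_of_dominatedInput` pass between the two; both rest on a mild solution seeing its
nonlinearity only almost everywhere along its own trajectory.

(1) ⇒ (2) is a composition of Lipschitz maps. For (2) ⇒ (3), choose levels `c k` so rapidly
increasing that states and inputs of size below `c k` stay below `c (k + 1)` up to time `k`, and a
gain so slow that `η (c (k + 1)) < c k`. A dominated trajectory that first reached `c (k + 1)`
before time `k` would be driven until then by an input of size below `c k`, contradicting the choice
of `c (k + 1)` (`exists_isRFCDominated`).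

For (3) ⇒ (4), robust forward completeness bounds every closed-loop solution a priori. Picard
iteration for a radially truncated nonlinearity then gives existence on each compact interval, and
Grönwall gives uniqueness and the Lipschitz estimate. For (4) ⇒ (5), convert `u₁` into a
disturbance, run the closed loop from `x₂` with it, and read off `u₂`. -/

/-- Composition of a Carathéodory function with a strongly measurable function. -/
theorem aestronglyMeasurable_comp_of_caratheodory {α E F : Type*} [MeasurableSpace α]
    {μ : Measure α} [TopologicalSpace E] [TopologicalSpace F] [TopologicalSpace.PseudoMetrizableSpace F]
    {G : α → E → F} (hG : ∀ x, AEStronglyMeasurable (fun a => G a x) μ)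
    (hc : ∀ᵐ a ∂μ, Continuous (G a)) {g : α → E} (hg : AEStronglyMeasurable g μ) :
    AEStronglyMeasurable (fun a => G a (g a)) μ := by
  obtain ⟨g', hg', hgg'⟩ := hg
  have key : ∀ n, AEStronglyMeasurable (fun a => G a (hg'.approx n a)) μ := by
    intro n
    -- A simple function takes finitely many values. On each of its fibres the composite is `G · y`
    -- for a fixed `y`, and these fibres cover the space.
    have hU : (⋃ y : (hg'.approx n).range, hg'.approx n ⁻¹' {(y : E)}) = univ := by
      ext a; simp
    rw [← Measure.restrict_univ (μ := μ), ← hU, aestronglyMeasurable_iUnion_iff]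
    rintro ⟨y, hy⟩
    refine (hG y).restrict.congr ?_
    filter_upwards [ae_restrict_mem ((hg'.approx n).measurableSet_fiber y)] with a ha
    rw [show hg'.approx n a = y from ha]
  refine aestronglyMeasurable_of_tendsto_ae atTop key ?_
  filter_upwards [hc, hgg'] with a ha hga
  rw [hga]
  exact (ha.tendsto _).comp (hg'.tendsto_approx a)

/-- Integral form of Grönwall's inequality. -/
theorem le_mul_exp_of_le_add_integral {w : ℝ → ℝ} {T δ K : ℝ} (hT : 0 ≤ T) (hK : 0 ≤ K)
    (hw : ContinuousOn w (Icc 0 T))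
    (h : ∀ t ∈ Icc (0 : ℝ) T, w t ≤ δ + K * ∫ s in (0 : ℝ)..t, w s) :
    ∀ t ∈ Icc (0 : ℝ) T, w t ≤ δ * Real.exp (K * t) := by
  -- Extending `w` by its endpoint values gives a function continuous on all of `ℝ`, so its
  -- primitive is differentiable everywhere, endpoints included.
  have hcont : Continuous (IccExtend hT ((Icc 0 T).domRestrict w)) :=
    (continuousOn_iff_continuous_domRestrict.1 hw).Icc_extend'
  set v := IccExtend hT ((Icc 0 T).domRestrict w) with hv
  have hvw : ∀ t ∈ Icc (0 : ℝ) T, v t = w t := fun t ht => by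
    rw [hv, IccExtend_of_mem hT _ ht, domRestrict_apply]
  have hint : ∀ t ∈ Icc (0 : ℝ) T, ∫ s in (0 : ℝ)..t, w s = ∫ s in (0 : ℝ)..t, v s := by
    intro t ht
    refine intervalIntegral.integral_congr fun s hs => ?_
    rw [uIcc_of_le ht.1] at hs
    exact (hvw s ⟨hs.1, hs.2.trans ht.2⟩).symm
  have hder : ∀ t, HasDerivAt (fun t => δ + K * ∫ s in (0 : ℝ)..t, v s) (K * v t) t := fun t =>
    ((hcont.integral_hasStrictDerivAt 0 t).hasDerivAt.const_mul K).const_add δ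
  have hg := le_gronwallBound_of_liminf_deriv_right_le
    (f := fun t => δ + K * ∫ s in (0 : ℝ)..t, v s) (f' := fun t => K * v t)
    (δ := δ) (K := K) (ε := 0) (a := 0) (b := T)
    (fun t _ => (hder t).continuousAt.continuousWithinAt)
    (fun t _ r hr => (hder t).hasDerivWithinAt.liminf_right_slope_le hr) (by simp)
    (fun t ht => by
      have ht' := Ico_subset_Icc_self ht
      rw [add_zero, hvw t ht', ← hint t ht']
      exact mul_le_mul_of_nonneg_left (h t ht') hK)
  intro t ht
  have := hg t ht
  rw [gronwallBound_ε0, sub_zero] at this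
  refine (h t ht).trans ?_
  rw [hint t ht]
  exact this

/-! ### Radial retraction; local boundedness and strong continuity of semigroups -/

section

variable {X : Type*} [NormedAddCommGroup X] [NormedSpace ℝ X]

/-- The radial retraction of a normed space onto the closed ball of radius `R`. -/
noncomputable def radialRetraction (R : ℝ) (x : X) : X := (R / max R ‖x‖) • x

theorem radialRetraction_of_norm_le {R : ℝ} (hR : 0 < R) {x : X} (hx : ‖x‖ ≤ R) :
    radialRetraction R x = x := by
  rw [radialRetraction, max_eq_left hx, div_self hR.ne', one_smul]

theorem norm_radialRetraction_le {R : ℝ} (hR : 0 < R) (x : X) : ‖radialRetraction R x‖ ≤ R := by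
  have h : 0 < max R ‖x‖ := lt_max_of_lt_left hR
  rw [radialRetraction, norm_smul, Real.norm_of_nonneg (by positivity), div_mul_eq_mul_div,
    div_le_iff₀ h]
  exact mul_le_mul_of_nonneg_left (le_max_right _ _) hR.le

/-- The difference splits into the scaled vector `x - y` and the change of the scaling factor
applied to `y`. Each part costs at most `‖x - y‖`, hence the constant `2`, valid in every normed
space. -/
theorem norm_radialRetraction_sub_le {R : ℝ} (hR : 0 < R) (x y : X) :
    ‖radialRetraction R x - radialRetraction R y‖ ≤ 2 * ‖x - y‖ := by
  have hx : 0 < max R ‖x‖ := lt_max_of_lt_left hR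
  have hy : 0 < max R ‖y‖ := lt_max_of_lt_left hR
  have h1 : radialRetraction R x - radialRetraction R y =
      (R / max R ‖x‖) • (x - y) + (R / max R ‖x‖ - R / max R ‖y‖) • y := by
    simp only [radialRetraction]; module
  have h2 : |R / max R ‖x‖ - R / max R ‖y‖| * ‖y‖ ≤ ‖x - y‖ := by
    have e : R / max R ‖x‖ - R / max R ‖y‖ =
        (R / max R ‖x‖) * ((max R ‖y‖ - max R ‖x‖) / max R ‖y‖) := by field_simp
    rw [e, abs_mul, abs_of_pos (div_pos hR hx), abs_div, abs_of_pos hy]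
    have a1 : R / max R ‖x‖ ≤ 1 := (div_le_one hx).2 (le_max_left _ _)
    have a2 : |max R ‖y‖ - max R ‖x‖| ≤ ‖x - y‖ := by
      refine (abs_max_sub_max_le_max _ _ _ _).trans ?_
      rw [sub_self, abs_zero, max_eq_right (abs_nonneg _), norm_sub_rev]
      exact abs_norm_sub_norm_le _ _
    have a3 : ‖y‖ / max R ‖y‖ ≤ 1 := (div_le_one hy).2 (le_max_right _ _)
    calc _ = (R / max R ‖x‖) * (|max R ‖y‖ - max R ‖x‖| * (‖y‖ / max R ‖y‖)) := by ring
      _ ≤ 1 * (‖x - y‖ * 1) := by gcongr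
      _ = _ := by ring
  rw [h1]
  refine (norm_add_le _ _).trans ?_
  rw [norm_smul, norm_smul, Real.norm_of_nonneg (div_pos hR hx).le, Real.norm_eq_abs, two_mul]
  refine add_le_add ?_ h2
  exact mul_le_of_le_one_left (norm_nonneg _) ((div_le_one hx).2 (le_max_left _ _))

variable {S : ℝ → X →L[ℝ] X}

/-- Otherwise `‖S (t n)‖ → ∞` along some `t n → 0`, although every orbit `S (t n) x` converges; this
contradicts Banach–Steinhaus. -/
theorem IsC0Semigroup.exists_norm_le_near_zero [CompleteSpace X] (hS : IsC0Semigroup S) :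
    ∃ δ > 0, ∃ M : ℝ, ∀ t ∈ Icc (0 : ℝ) δ, ‖S t‖ ≤ M := by
  by_contra! hcon
  -- Adding `‖S 0‖` forces `t n ≠ 0`, since strong continuity is only assumed along positive times.
  have h : ∀ n : ℕ, ∃ t ∈ Icc (0 : ℝ) (1 / ((n : ℝ) + 1)), (n : ℝ) + ‖S 0‖ < ‖S t‖ := fun n =>
    hcon _ (by positivity) _
  choose t ht htM using h
  have ht0 : ∀ n, 0 < t n := by
    intro n
    refine lt_of_le_of_ne (ht n).1 fun h0 => ?_
    have := htM n
    rw [← h0] at this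
    have : (0 : ℝ) ≤ n := n.cast_nonneg
    linarith
  have hlim : Tendsto t atTop (𝓝[>] 0) := by
    refine tendsto_nhdsWithin_iff.2 ⟨?_, Eventually.of_forall ht0⟩
    exact squeeze_zero (fun n => (ht n).1) (fun n => (ht n).2) tendsto_one_div_add_atTop_nhds_zero_nat
  obtain ⟨C, hC⟩ := banach_steinhaus (g := fun n => S (t n)) fun x => by
    obtain ⟨C, hC⟩ := ((hS.tendsto_zero x).comp hlim).norm.bddAbove_range
    exact ⟨C, fun n => hC ⟨n, rfl⟩⟩
  obtain ⟨n, hn⟩ := exists_nat_gt C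
  have := htM n
  have := hC n
  have := norm_nonneg (S 0)
  linarith

/-- The bound near zero propagates by the semigroup law: each further step of length `δ` costs a
factor `max 1 M`. -/
theorem IsC0Semigroup.exists_norm_le [CompleteSpace X] (hS : IsC0Semigroup S) (T : ℝ) :
    ∃ M : ℝ, 1 ≤ M ∧ ∀ t ∈ Icc (0 : ℝ) T, ‖S t‖ ≤ M := by
  obtain ⟨δ, hδ, M, hM⟩ := hS.exists_norm_le_near_zero
  have key : ∀ n : ℕ, ∀ t ∈ Icc (0 : ℝ) ((n + 1) * δ), ‖S t‖ ≤ max 1 M ^ (n + 1) := by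
    intro n
    induction n with
    | zero =>
      intro t ht
      rw [zero_add, pow_one]
      exact (hM t (by simpa using ht)).trans (le_max_right _ _)
    | succ n ih =>
      intro t ht
      rcases le_total t δ with h | h
      · refine (hM t ⟨ht.1, h⟩).trans ((le_max_right 1 M).trans ?_)
        exact le_self_pow₀ (le_max_left _ _) (by omega)
      · have h1 : S t = (S δ).comp (S (t - δ)) := by
          rw [← hS.map_add δ (t - δ) hδ.le (by linarith)]; congr 1; ring
        rw [h1, pow_succ']
        refine (ContinuousLinearMap.opNorm_comp_le _ _).trans ?_
        refine mul_le_mul ((hM δ ⟨hδ.le, le_rfl⟩).trans (le_max_right _ _)) (ih _ ⟨by linarith, ?_⟩)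
          (norm_nonneg _) (by positivity)
        have := ht.2
        push_cast at this
        linarith
  obtain ⟨n, hn⟩ := exists_nat_gt (T / δ)
  rw [div_lt_iff₀ hδ] at hn
  exact ⟨max 1 M ^ (n + 1), one_le_pow₀ (le_max_left _ _), fun t ht => key n t
    ⟨ht.1, ht.2.trans (by nlinarith)⟩⟩

/-- Factoring out the operator at the earlier time reduces both one-sided limits to right continuity
at zero, with a locally uniform operator bound. -/
theorem IsC0Semigroup.continuousOn [CompleteSpace X] (hS : IsC0Semigroup S) (x : X) :
    ContinuousOn (fun t => S t x) (Ici 0) := by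
  have h0 : Tendsto (fun t => S t x) (𝓝[≥] 0) (𝓝 x) := by
    rw [← Ioi_insert, nhdsWithin_insert, tendsto_sup, tendsto_pure_left]
    refine ⟨fun s hs => ?_, hS.tendsto_zero x⟩
    rw [hS.map_zero]
    exact mem_of_mem_nhds hs
  intro t ht
  obtain ⟨M, hM1, hM⟩ := hS.exists_norm_le (t + 1)
  have hlim : Tendsto (fun r => M * ‖S |r - t| x - x‖) (𝓝[Ici 0] t) (𝓝 0) := by
    have hr : Tendsto (fun r => |r - t|) (𝓝 t) (𝓝[≥] 0) := by
      refine tendsto_nhdsWithin_iff.2 ⟨?_, Eventually.of_forall fun r => mem_Ici.2 (abs_nonneg _)⟩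
      have : ContinuousAt (fun r => |r - t|) t := by fun_prop
      simpa [ContinuousAt] using this
    have h2 := ((h0.comp hr).sub_const x).norm.const_mul M
    refine Tendsto.mono_left ?_ nhdsWithin_le_nhds
    simpa using h2
  rw [ContinuousWithinAt, tendsto_iff_norm_sub_tendsto_zero]
  refine squeeze_zero' (Eventually.of_forall fun _ => norm_nonneg _) ?_ hlim
  filter_upwards [self_mem_nhdsWithin, mem_nhdsWithin_of_mem_nhds (Iio_mem_nhds (lt_add_one t))]
    with r hr hrt
  have hr : 0 ≤ r := hr
  have hrt : r < t + 1 := hrt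
  have ht : 0 ≤ t := ht
  have key : ∀ a b : ℝ, 0 ≤ a → a ≤ b → a < t + 1 → ‖S b x - S a x‖ ≤ M * ‖S (b - a) x - x‖ := by
    intro a b ha hab hat
    have h1 : S b x = S a (S (b - a) x) := by
      rw [← ContinuousLinearMap.comp_apply, ← hS.map_add a (b - a) ha (by linarith)]
      congr 2; ring
    rw [h1, ← map_sub]
    exact (S a).le_of_opNorm_le (hM a ⟨ha, hat.le⟩) _
  rcases le_total r t with h | h
  · rw [norm_sub_rev, abs_of_nonpos (by linarith), neg_sub]
    exact key r t hr h hrt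
  · rw [abs_of_nonneg (by linarith)]
    exact key t r ht h (lt_add_one t)

end


/-! ### Variation of constants and Picard iteration -/

section

variable {X : Type*} [NormedAddCommGroup X] [NormedSpace ℝ X] [CompleteSpace X]
  {S : ℝ → X →L[ℝ] X}

theorem IsC0Semigroup.aestronglyMeasurable_conv (hS : IsC0Semigroup S) {g : ℝ → X} {t : ℝ}
    (hg : AEStronglyMeasurable g (volume.restrict (Icc 0 t))) :
    AEStronglyMeasurable (fun s => S (t - s) (g s)) (volume.restrict (Icc 0 t)) := by
  refine aestronglyMeasurable_comp_of_caratheodory (G := fun s x => S (t - s) x) (fun x => ?_)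
    (Eventually.of_forall fun s => (S (t - s)).continuous) hg
  refine ContinuousOn.aestronglyMeasurable ?_ measurableSet_Icc
  exact (hS.continuousOn x).comp (by fun_prop) fun s hs => sub_nonneg.2 hs.2

theorem IsC0Semigroup.intervalIntegrable_conv (hS : IsC0Semigroup S) {g : ℝ → X} {t B : ℝ}
    (ht : 0 ≤ t) (hg : AEStronglyMeasurable g (volume.restrict (Icc 0 t)))
    (hB : ∀ᵐ s ∂volume.restrict (Icc 0 t), ‖g s‖ ≤ B) :
    IntervalIntegrable (fun s => S (t - s) (g s)) volume 0 t := by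
  obtain ⟨M, hM1, hM⟩ := hS.exists_norm_le t
  rw [intervalIntegrable_iff_integrableOn_Icc_of_le ht]
  refine Integrable.mono' (g := fun _ => M * B) (integrable_const _)
    (hS.aestronglyMeasurable_conv hg) ?_
  filter_upwards [hB, ae_restrict_mem measurableSet_Icc] with s hs hst
  have h1 := hM (t - s) ⟨sub_nonneg.2 hst.2, by linarith [hst.1]⟩
  exact ((S (t - s)).le_of_opNorm_le h1 _).trans (by gcongr)

/-- Written over the fixed interval `[0, T]` with an indicator, the integrand is dominated by `M *
B` and continuous in `t` at `t₀` for every `s ≠ t₀`, so dominated convergence applies. -/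
theorem IsC0Semigroup.continuousOn_conv (hS : IsC0Semigroup S) {g : ℝ → X} {T B : ℝ}
    (hg : AEStronglyMeasurable g (volume.restrict (Icc 0 T)))
    (hB : ∀ᵐ s ∂volume.restrict (Icc 0 T), ‖g s‖ ≤ B) :
    ContinuousOn (fun t => ∫ s in (0 : ℝ)..t, S (t - s) (g s)) (Icc 0 T) := by
  obtain ⟨M, hM1, hM⟩ := hS.exists_norm_le T
  have hint : ∀ t ∈ Icc (0 : ℝ) T, ∫ s in (0 : ℝ)..t, S (t - s) (g s) =
      ∫ s in Icc 0 T, (Icc 0 t).indicator (fun s => S (t - s) (g s)) s := by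
    intro t ht
    rw [intervalIntegral.integral_of_le ht.1, ← integral_Icc_eq_integral_Ioc,
      setIntegral_indicator measurableSet_Icc,
      inter_eq_self_of_subset_right (Icc_subset_Icc_right ht.2)]
  refine ContinuousOn.congr ?_ hint
  intro t₀ ht₀
  refine continuousWithinAt_of_dominated (bound := fun _ => M * B) ?_ ?_ (integrable_const _) ?_
  · filter_upwards [self_mem_nhdsWithin] with t ht
    rw [aestronglyMeasurable_indicator_iff measurableSet_Icc, Measure.restrict_restrict
      measurableSet_Icc, inter_eq_self_of_subset_left (Icc_subset_Icc_right ht.2)]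
    exact hS.aestronglyMeasurable_conv (hg.mono_measure
      (Measure.restrict_mono (Icc_subset_Icc_right ht.2) le_rfl))
  · filter_upwards [self_mem_nhdsWithin] with t ht
    filter_upwards [hB] with s hs
    have hB0 : 0 ≤ B := (norm_nonneg _).trans hs
    by_cases hst : s ∈ Icc 0 t
    · rw [indicator_of_mem hst]
      have h1 := hM (t - s) ⟨sub_nonneg.2 hst.2, by linarith [hst.1, ht.2]⟩
      exact ((S (t - s)).le_of_opNorm_le h1 _).trans (by gcongr)
    · rw [indicator_of_notMem hst, norm_zero]
      positivity
  · have hne : ∀ᵐ s ∂volume.restrict (Icc (0 : ℝ) T), s ≠ t₀ :=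
      ae_restrict_of_ae (Measure.ae_ne volume t₀)
    filter_upwards [hne, ae_restrict_mem measurableSet_Icc] with s hs hsT
    refine ContinuousAt.continuousWithinAt ?_
    rcases lt_or_gt_of_ne hs with h | h
    · have hc : ContinuousAt (fun t => S (t - s) (g s)) t₀ := by
        have h1 : ContinuousAt (fun r => S r (g s)) (t₀ - s) :=
          (hS.continuousOn (g s)).continuousAt (Ici_mem_nhds (sub_pos.2 h))
        exact ContinuousAt.comp (f := fun t => t - s) h1 (by fun_prop)
      refine hc.congr ?_
      filter_upwards [Ioi_mem_nhds h] with t ht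
      have hmem : s ∈ Icc 0 t := ⟨hsT.1, le_of_lt ht⟩
      rw [indicator_of_mem hmem]
    · refine (continuousAt_const (y := (0 : X))).congr ?_
      filter_upwards [Iio_mem_nhds h] with t ht
      rw [indicator_of_notMem]
      exact fun hh => not_le_of_gt ht hh.2

omit [CompleteSpace X] in
/-- Comparison of two variation-of-constants formulas. -/
theorem norm_duhamel_sub_le {g₁ g₂ : ℝ → X} {k : ℝ → ℝ} {x₁ x₂ : X} {t T M : ℝ}
    (hM : ∀ r ∈ Icc (0 : ℝ) T, ‖S r‖ ≤ M) (ht : t ∈ Icc 0 T)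
    (h₁ : IntervalIntegrable (fun s => S (t - s) (g₁ s)) volume 0 t)
    (h₂ : IntervalIntegrable (fun s => S (t - s) (g₂ s)) volume 0 t)
    (hk : ContinuousOn k (Icc 0 T))
    (hle : ∀ᵐ s ∂volume.restrict (Icc 0 T), ‖g₁ s - g₂ s‖ ≤ k s) :
    ‖(S t x₁ + ∫ s in (0 : ℝ)..t, S (t - s) (g₁ s)) -
        (S t x₂ + ∫ s in (0 : ℝ)..t, S (t - s) (g₂ s))‖ ≤
      M * ‖x₁ - x₂‖ + M * ∫ s in (0 : ℝ)..t, k s := by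
  rw [add_sub_add_comm, ← map_sub, ← intervalIntegral.integral_sub h₁ h₂]
  refine (norm_add_le _ _).trans (add_le_add ((S t).le_of_opNorm_le (hM t ht) _) ?_)
  rw [← intervalIntegral.integral_const_mul]
  refine intervalIntegral.norm_integral_le_of_norm_le ht.1 ?_ ?_
  · rw [ae_restrict_iff' measurableSet_Icc] at hle
    filter_upwards [hle] with s hs hst
    rw [← map_sub]
    refine ((S (t - s)).le_of_opNorm_le (hM _ ⟨sub_nonneg.2 hst.2, ?_⟩) _).trans ?_
    · linarith [hst.1, ht.2]
    · have : 0 ≤ M := (norm_nonneg _).trans (hM t ht)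
      gcongr
      exact hs ⟨hst.1.le, hst.2.trans ht.2⟩
  · refine ContinuousOn.intervalIntegrable ?_
    rw [uIcc_of_le ht.1]
    exact (hk.mono (Icc_subset_Icc_right ht.2)).const_mul M

/-- Existence of mild solutions for bounded, globally Lipschitz nonlinearities. -/
theorem IsC0Semigroup.exists_isMildSolution (hS : IsC0Semigroup S) {G : ℝ → X → X} {T K B : ℝ}
    (hT : 0 ≤ T) (hK : 0 ≤ K)
    (hm : ∀ x, AEStronglyMeasurable (fun s => G s x) (volume.restrict (Icc 0 T)))
    (hL : ∀ᵐ s ∂volume.restrict (Icc 0 T), ∀ x y, ‖G s x - G s y‖ ≤ K * ‖x - y‖)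
    (hB : ∀ᵐ s ∂volume.restrict (Icc 0 T), ∀ x, ‖G s x‖ ≤ B) (x₀ : X) :
    ∃ y, IsMildSolution S G x₀ T y := by
  obtain ⟨M, hM1, hM⟩ := hS.exists_norm_le T
  -- The iteration runs in the complete space `C([0, T], X)`; constant extension turns its elements
  -- into functions on `ℝ`.
  let E : C(Icc (0 : ℝ) T, X) → ℝ → X := fun y => IccExtend hT y
  have hE : ∀ y, Continuous (E y) := fun y => y.continuous.Icc_extend'
  have hgm : ∀ y, AEStronglyMeasurable (fun s => G s (E y s)) (volume.restrict (Icc 0 T)) :=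
    fun y => aestronglyMeasurable_comp_of_caratheodory hm
      (hL.mono fun s hs => by
        refine (LipschitzWith.of_dist_le_mul (K := ⟨K, hK⟩) fun x y => ?_).continuous
        rw [dist_eq_norm, dist_eq_norm]
        exact hs x y)
      (hE y).aestronglyMeasurable
  have hgB : ∀ y, ∀ᵐ s ∂volume.restrict (Icc 0 T), ‖G s (E y s)‖ ≤ B :=
    fun y => hB.mono fun s hs => hs _
  let P : C(Icc (0 : ℝ) T, X) → ℝ → X := fun y t =>
    S t x₀ + ∫ s in (0 : ℝ)..t, S (t - s) (G s (E y s))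
  have hP : ∀ y, ContinuousOn (P y) (Icc 0 T) := fun y =>
    ((hS.continuousOn x₀).mono Icc_subset_Ici_self).add (hS.continuousOn_conv (hgm y) (hgB y))
  have hI : ∀ y, ∀ t ∈ Icc (0 : ℝ) T,
      IntervalIntegrable (fun s => S (t - s) (G s (E y s))) volume 0 t := fun y t ht => by
    have hle : volume.restrict (Icc 0 t) ≤ volume.restrict (Icc (0 : ℝ) T) :=
      Measure.restrict_mono (Icc_subset_Icc_right ht.2) le_rfl
    exact hS.intervalIntegrable_conv ht.1 ((hgm y).mono_measure hle) (ae_mono hle (hgB y))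
  let Φ : C(Icc (0 : ℝ) T, X) → C(Icc (0 : ℝ) T, X) := fun y =>
    ⟨(Icc 0 T).domRestrict (P y), (hP y).domRestrict⟩
  have hEΦ : ∀ y, ∀ t ∈ Icc (0 : ℝ) T, E (Φ y) t = P y t := fun y t ht =>
    IccExtend_of_mem hT _ ht
  -- `Φ` itself need not contract. Iterating the Volterra estimate produces a factor `1 / n!`, which
  -- makes some iterate a contraction; its fixed point is also fixed by `Φ`.
  have hiter : ∀ (n : ℕ) (y z : C(Icc (0 : ℝ) T, X)), ∀ t ∈ Icc (0 : ℝ) T,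
      ‖E (Φ^[n] y) t - E (Φ^[n] z) t‖ ≤ (M * K * t) ^ n / n.factorial * dist y z := by
    intro n y z
    induction n with
    | zero =>
      intro t ht
      simp only [Function.iterate_zero, id_eq, pow_zero, Nat.factorial_zero, Nat.cast_one, div_one,
        one_mul]
      rw [← dist_eq_norm]
      exact ContinuousMap.dist_apply_le_dist _
    | succ n ih =>
      intro t ht
      rw [Function.iterate_succ_apply', Function.iterate_succ_apply', hEΦ _ t ht, hEΦ _ t ht]
      have h := norm_duhamel_sub_le (x₁ := x₀) (x₂ := x₀) hM ht (hI (Φ^[n] y) t ht)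
        (hI (Φ^[n] z) t ht)
        (k := fun s => K * ((M * K * s) ^ n / n.factorial * dist y z)) (by fun_prop) (by
          filter_upwards [hL, ae_restrict_mem measurableSet_Icc] with s hs hsT
          exact (hs _ _).trans (by gcongr; exact ih s hsT))
      refine h.trans (le_of_eq ?_)
      have : ∫ s in (0 : ℝ)..t, K * ((M * K * s) ^ n / n.factorial * dist y z) =
          K * ((M * K) ^ n / n.factorial * dist y z) * ∫ s in (0 : ℝ)..t, s ^ n := by
        rw [← intervalIntegral.integral_const_mul]
        congr 1; ext s; rw [mul_pow]; ring
      rw [this, integral_pow, sub_self, norm_zero, Nat.factorial_succ]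
      push_cast
      field_simp
      ring
  have hdist : ∀ (n : ℕ) (y z : C(Icc (0 : ℝ) T, X)),
      dist (Φ^[n] y) (Φ^[n] z) ≤ (M * K * T) ^ n / n.factorial * dist y z := by
    intro n y z
    refine (ContinuousMap.dist_le (by positivity)).2 fun t => ?_
    have h := hiter n y z t t.2
    rw [show E (Φ^[n] y) t = Φ^[n] y t from IccExtend_val hT _ t,
      show E (Φ^[n] z) t = Φ^[n] z t from IccExtend_val hT _ t] at h
    rw [dist_eq_norm]
    have ht0 := t.2.1
    have htT := t.2.2
    exact h.trans (by gcongr)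
  obtain ⟨n, hn⟩ := ((FloorSemiring.tendsto_pow_div_factorial_atTop (M * K * T)).eventually
    (gt_mem_nhds (zero_lt_one' ℝ))).exists
  have hc : ContractingWith ⟨(M * K * T) ^ n / n.factorial, by positivity⟩ Φ^[n] :=
    ⟨hn, LipschitzWith.of_dist_le_mul fun y z => hdist n y z⟩
  have hfix := hc.isFixedPt_fixedPoint_iterate
  set y := ContractingWith.fixedPoint Φ^[n] hc
  refine ⟨E y, (hE y).continuousOn, fun t ht => ⟨hI y t ht, ?_⟩⟩
  have h := hEΦ y t ht
  rw [hfix.eq] at h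
  exact h

end


/-! ### Mild solutions: uniqueness, a priori bounds, gluing -/

/-- A continuous function that starts below the level `R` and exceeds it has a first hitting
time of `R`. -/
theorem exists_first_hitting_time {w : ℝ → ℝ} {T R : ℝ} (hT : 0 ≤ T)
    (hw : ContinuousOn w (Icc 0 T)) (h0 : w 0 < R) (hR : R ≤ w T) :
    ∃ t ∈ Ioc 0 T, w t = R ∧ ∀ s ∈ Icc 0 t, w s ≤ R := by
  have hcl : IsClosed (Icc 0 T ∩ w ⁻¹' Ici R) := hw.preimage_isClosed_of_isClosed isClosed_Icc
    isClosed_Ici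
  obtain ⟨t, ⟨htT, htR⟩, hmin⟩ := (isCompact_Icc.of_isClosed_subset hcl inter_subset_left
    ).exists_isLeast ⟨T, ⟨hT, le_rfl⟩, hR⟩
  obtain ⟨s, hs, hsR⟩ := intermediate_value_Icc htT.1 (hw.mono (Icc_subset_Icc_right htT.2))
    ⟨h0.le, htR⟩
  have hst : t ≤ s := hmin ⟨⟨hs.1, hs.2.trans htT.2⟩, hsR.ge⟩
  obtain rfl : s = t := le_antisymm hs.2 hst
  refine ⟨s, ⟨lt_of_le_of_ne hs.1 ?_, htT.2⟩, hsR, fun r hr => ?_⟩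
  · rintro rfl
    exact h0.ne hsR
  · by_contra! hlt
    have := hmin ⟨⟨hr.1, hr.2.trans htT.2⟩, hlt.le⟩
    obtain rfl : r = s := le_antisymm hr.2 this
    exact hlt.ne' hsR

section

variable {X : Type*} [NormedAddCommGroup X] [NormedSpace ℝ X]
  {S : ℝ → X →L[ℝ] X} {g g' : ℝ → X → X} {x₀ : X} {T : ℝ} {y z : ℝ → X}

theorem IsMildSolution.mono (h : IsMildSolution S g x₀ T y) {T' : ℝ} (hT : T' ≤ T) :
    IsMildSolution S g x₀ T' y :=
  ⟨h.1.mono (Icc_subset_Icc_right hT), fun t ht => h.2 t ⟨ht.1, ht.2.trans hT⟩⟩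

/-- Only the values of the nonlinearity along the trajectory, up to null sets, enter the integral.
Hence one function can solve the open-loop, closed-loop and truncated equations at once. -/
theorem IsMildSolution.congr (h : IsMildSolution S g x₀ T y) (hyz : EqOn z y (Icc 0 T))
    (hg : ∀ᵐ s ∂volume.restrict (Icc 0 T), g' s (y s) = g s (y s)) :
    IsMildSolution S g' x₀ T z := by
  refine ⟨h.1.congr hyz, fun t ht => ?_⟩
  have hae : ∀ᵐ s ∂volume, s ∈ uIoc 0 t → S (t - s) (g s (y s)) = S (t - s) (g' s (z s)) := by
    rw [ae_restrict_iff' measurableSet_Icc] at hg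
    filter_upwards [hg] with s hs hst
    rw [uIoc_of_le ht.1] at hst
    have hsT : s ∈ Icc 0 T := ⟨hst.1.le, hst.2.trans ht.2⟩
    rw [hyz hsT, hs hsT]
  refine ⟨(h.2 t ht).1.congr_ae ((ae_restrict_iff' measurableSet_uIoc).2 hae), ?_⟩
  rw [hyz ht, (h.2 t ht).2, intervalIntegral.integral_congr_ae hae]

theorem IsMildSolution.apply_zero (hS : IsC0Semigroup S) (h : IsMildSolution S g x₀ T y)
    (hT : 0 ≤ T) : y 0 = x₀ := by
  simpa [hS.map_zero] using (h.2 0 ⟨le_rfl, hT⟩).2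

theorem IsUniqueGlobalMildSolution.continuousOn (h : IsUniqueGlobalMildSolution S g x₀ y) :
    ContinuousOn y (Ici 0) := by
  intro t ht
  have ht : 0 ≤ t := ht
  have h1 := (h (t + 1) (by linarith)).1.1 t ⟨ht, by linarith⟩
  refine h1.mono_of_mem_nhdsWithin ?_
  rw [mem_nhdsWithin_iff_exists_mem_nhds_inter]
  exact ⟨Iio (t + 1), Iio_mem_nhds (by linarith), fun s hs => ⟨hs.2, le_of_lt hs.1⟩⟩

theorem IsUniqueGlobalMildSolution.apply_zero (hS : IsC0Semigroup S)
    (h : IsUniqueGlobalMildSolution S g x₀ y) : y 0 = x₀ :=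
  (h 1 one_pos).1.apply_zero hS zero_le_one

/-- Lipschitz dependence of mild solutions on the initial value. -/
theorem IsMildSolution.norm_sub_le {x₁ x₂ : X} {y₁ y₂ : ℝ → X} {K M R : ℝ} (hT : 0 ≤ T)
    (hK : 0 ≤ K) (hM : ∀ r ∈ Icc (0 : ℝ) T, ‖S r‖ ≤ M)
    (h₁ : IsMildSolution S g x₁ T y₁) (h₂ : IsMildSolution S g x₂ T y₂)
    (hR₁ : ∀ t ∈ Icc 0 T, ‖y₁ t‖ ≤ R) (hR₂ : ∀ t ∈ Icc 0 T, ‖y₂ t‖ ≤ R)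
    (hL : ∀ᵐ s ∂volume.restrict (Icc 0 T), ∀ x y, ‖x‖ ≤ R → ‖y‖ ≤ R →
      ‖g s x - g s y‖ ≤ K * ‖x - y‖) :
    ∀ t ∈ Icc 0 T, ‖y₁ t - y₂ t‖ ≤ M * ‖x₁ - x₂‖ * Real.exp (M * K * t) := by
  have hM0 : 0 ≤ M := (norm_nonneg _).trans (hM 0 ⟨le_rfl, hT⟩)
  have hc : ContinuousOn (fun s => ‖y₁ s - y₂ s‖) (Icc 0 T) := (h₁.1.sub h₂.1).norm
  refine le_mul_exp_of_le_add_integral hT (mul_nonneg hM0 hK) hc fun t ht => ?_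
  have h := norm_duhamel_sub_le (x₁ := x₁) (x₂ := x₂) (k := fun s => K * ‖y₁ s - y₂ s‖) hM ht
    (h₁.2 t ht).1 (h₂.2 t ht).1 (hc.const_mul K) (by
      filter_upwards [hL, ae_restrict_mem measurableSet_Icc] with s hs hsT
      exact hs _ _ (hR₁ s hsT) (hR₂ s hsT))
  rw [← (h₁.2 t ht).2, ← (h₂.2 t ht).2, intervalIntegral.integral_const_mul, ← mul_assoc] at h
  exact h

/-- Local Lipschitz continuity on bounded sets, uniformly in time on `[0, T]`. -/
def IsLocallyLipschitzOn (g : ℝ → X → X) (T : ℝ) : Prop :=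
  ∀ R : ℝ, 0 < R → ∃ K : ℝ, 0 ≤ K ∧ ∀ᵐ s ∂volume.restrict (Icc 0 T), ∀ x y, ‖x‖ ≤ R → ‖y‖ ≤ R →
    ‖g s x - g s y‖ ≤ K * ‖x - y‖

omit [NormedSpace ℝ X] in
theorem exists_norm_le_of_continuousOn_Icc (hy : ContinuousOn y (Icc 0 T)) :
    ∃ R, 0 < R ∧ ∀ t ∈ Icc 0 T, ‖y t‖ ≤ R := by
  obtain ⟨R, hR⟩ := isCompact_Icc.exists_bound_of_continuousOn hy
  exact ⟨max R 1, by positivity, fun t ht => (hR t ht).trans (le_max_left _ _)⟩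

variable [CompleteSpace X]

theorem IsMildSolution.eqOn (hS : IsC0Semigroup S) (hT : 0 ≤ T) (hL : IsLocallyLipschitzOn g T)
    (hy : IsMildSolution S g x₀ T y) (hz : IsMildSolution S g x₀ T z) : EqOn y z (Icc 0 T) := by
  obtain ⟨M, hM1, hM⟩ := hS.exists_norm_le T
  obtain ⟨R₁, hR₁, hy'⟩ := exists_norm_le_of_continuousOn_Icc hy.1
  obtain ⟨R₂, hR₂, hz'⟩ := exists_norm_le_of_continuousOn_Icc hz.1
  obtain ⟨K, hK, hK'⟩ := hL (max R₁ R₂) (lt_max_of_lt_left hR₁)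
  intro t ht
  have h := IsMildSolution.norm_sub_le hT hK hM hy hz
    (fun t ht => (hy' t ht).trans (le_max_left _ _))
    (fun t ht => (hz' t ht).trans (le_max_right _ _)) hK' t ht
  rw [sub_self, norm_zero, mul_zero, zero_mul] at h
  exact sub_eq_zero.1 (norm_le_zero_iff.1 h)

/-- A priori bounds yield existence of mild solutions on the whole interval. -/
theorem exists_isMildSolution_of_apriori_bound (hS : IsC0Semigroup S) (hT : 0 ≤ T) {B N : ℝ}
    (hm : ∀ x, AEStronglyMeasurable (fun s => g s x) (volume.restrict (Icc 0 T)))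
    (hL : IsLocallyLipschitzOn g T) (hB : ∀ᵐ s ∂volume.restrict (Icc 0 T), ‖g s 0‖ ≤ B)
    (hN : ∀ T' ∈ Ioc 0 T, ∀ y, IsMildSolution S g x₀ T' y → ‖y T'‖ ≤ N) :
    ∃ y, IsMildSolution S g x₀ T y := by
  -- `R` lies strictly above `‖x₀‖` and the a priori bound. Up to a first time at level `R` the
  -- truncated solution solves the original equation, so its norm there is at most `N < R`; that
  -- level is never reached.
  set R := max N ‖x₀‖ + 1 with hRdef
  have hNR : N < R := by linarith [le_max_left N ‖x₀‖]
  have hxR : ‖x₀‖ < R := by linarith [le_max_right N ‖x₀‖]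
  have hR : 0 < R := (norm_nonneg _).trans_lt hxR
  obtain ⟨K, hK, hL'⟩ := hL R hR
  obtain ⟨y, hy⟩ := hS.exists_isMildSolution (G := fun s x => g s (radialRetraction R x))
    (K := K * 2) (B := B + K * R) hT (by positivity) (fun x => hm _) (by
      filter_upwards [hL'] with s hs x y
      refine (hs _ _ (norm_radialRetraction_le hR x) (norm_radialRetraction_le hR y)).trans ?_
      rw [mul_assoc]
      exact mul_le_mul_of_nonneg_left (norm_radialRetraction_sub_le hR x y) hK) (by
      filter_upwards [hL', hB] with s hs hs' x
      have h1 := hs _ 0 (norm_radialRetraction_le hR x) (by simpa using hR.le)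
      rw [sub_zero] at h1
      calc _ = ‖g s 0 + (g s (radialRetraction R x) - g s 0)‖ := by rw [add_sub_cancel]
        _ ≤ B + K * ‖radialRetraction R x‖ := (norm_add_le _ _).trans (add_le_add hs' h1)
        _ ≤ B + K * R := by gcongr; exact norm_radialRetraction_le hR x) x₀
  have key : ∀ T' ≤ T, (∀ t ∈ Icc 0 T', ‖y t‖ ≤ R) → IsMildSolution S g x₀ T' y := by
    intro T' hT' hle
    refine (hy.mono hT').congr (eqOn_refl _ _) ?_
    filter_upwards [ae_restrict_mem measurableSet_Icc] with s hs
    rw [radialRetraction_of_norm_le hR (hle s hs)]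
  refine ⟨y, key T le_rfl fun t ht => ?_⟩
  by_contra! hlt
  obtain ⟨t', ht', hR', hle⟩ := exists_first_hitting_time ht.1
    ((hy.1.mono (Icc_subset_Icc_right ht.2)).norm) (by rwa [hy.apply_zero hS hT]) hlt.le
  have := hN t' ⟨ht'.1, ht'.2.trans ht.2⟩ y (key t' (ht'.2.trans ht.2) hle)
  linarith

/-- Mild solutions on compact intervals are glued to a global one. -/
theorem exists_isUniqueGlobalMildSolution (hS : IsC0Semigroup S)
    (hL : ∀ T, 0 < T → IsLocallyLipschitzOn g T)
    (hex : ∀ T, 0 < T → ∃ y, IsMildSolution S g x₀ T y) :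
    ∃ y, IsUniqueGlobalMildSolution S g x₀ y := by
  have hn : ∀ n : ℕ, (0 : ℝ) < n + 1 := fun n => by positivity
  choose Y hY using fun n : ℕ => hex (n + 1) (hn n)
  have hglue : ∀ (n : ℕ), ∀ t ∈ Icc (0 : ℝ) (n + 1), Y ⌈t⌉₊ t = Y n t := by
    intro n t ht
    have h1 : 0 < min ((⌈t⌉₊ : ℝ) + 1) ((n : ℝ) + 1) := lt_min (hn _) (hn _)
    refine IsMildSolution.eqOn hS h1.le (hL _ h1) ((hY _).mono (min_le_left _ _))
      ((hY n).mono (min_le_right _ _)) ⟨ht.1, le_min ?_ ht.2⟩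
    linarith [Nat.le_ceil t]
  -- `Y n` is a solution on `[0, n + 1]`, so index `⌈t⌉₊` covers `t`; by uniqueness any other
  -- admissible index gives the same value.
  refine ⟨fun t => Y ⌈t⌉₊ t, fun T hT => ?_⟩
  have hmild : IsMildSolution S g x₀ T fun t => Y ⌈t⌉₊ t := by
    have h1 : T ≤ (⌈T⌉₊ : ℝ) + 1 := by linarith [Nat.le_ceil T]
    exact ((hY ⌈T⌉₊).congr (fun t ht => hglue _ t ht) (Eventually.of_forall fun _ => rfl)).mono h1
  exact ⟨hmild, fun z hz => hz.eqOn hS hT.le (hL T hT) hmild⟩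

end


/-! ### Inputs, and the open-loop/closed-loop correspondence -/

section

variable {X U : Type*} [NormedAddCommGroup X] [NormedAddCommGroup U]

theorem Input.ae_norm_le (u : Input U) : ∀ᵐ s ∂volume.restrict (Ici (0 : ℝ)), ‖u s‖ ≤ ‖u‖ := by
  filter_upwards [ae_le_eLpNormEssSup (f := u) (μ := volume.restrict (Ici (0 : ℝ)))] with s hs
  have h := Lp.enorm_def u
  rw [eLpNorm_exponent_top] at h
  rw [← h, enorm_le_iff_norm_le] at hs
  exact hs

theorem Input.exists_of_ae_bound {v : ℝ → U} {C : ℝ} (hC : 0 ≤ C)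
    (hv : AEStronglyMeasurable v (volume.restrict (Ici (0 : ℝ))))
    (hb : ∀ᵐ s ∂volume.restrict (Ici (0 : ℝ)), ‖v s‖ ≤ C) :
    ∃ u : Input U, ‖u‖ ≤ C ∧ ∀ᵐ s ∂volume.restrict (Ici (0 : ℝ)), u s = v s := by
  have hm := memLp_top_of_bound hv C hb
  refine ⟨hm.toLp v, ?_, hm.coeFn_toLp⟩
  rw [Lp.norm_toLp]
  refine ENNReal.toReal_le_of_le_ofReal hC ?_
  rw [eLpNorm_exponent_top]
  exact eLpNormEssSup_le_of_ae_bound hb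

theorem ae_Icc_of_ae_Ici {p : ℝ → Prop} (h : ∀ᵐ s ∂volume.restrict (Ici (0 : ℝ)), p s) (T : ℝ) :
    ∀ᵐ s ∂volume.restrict (Icc 0 T), p s :=
  ae_mono (Measure.restrict_mono Icc_subset_Ici_self le_rfl) h

/-- The truncation of an input to `[0, T]`. -/
theorem Input.exists_truncation {v : ℝ → U} {C T : ℝ} (hC : 0 ≤ C)
    (hv : AEStronglyMeasurable v (volume.restrict (Icc (0 : ℝ) T)))
    (hb : ∀ᵐ s ∂volume.restrict (Icc (0 : ℝ) T), ‖v s‖ ≤ C) :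
    ∃ u : Input U, ‖u‖ ≤ C ∧
      (∀ᵐ s ∂volume.restrict (Icc 0 T), u s = v s) ∧
      ∀ᵐ s ∂volume.restrict (Ici (0 : ℝ)), s ∉ Icc 0 T → u s = 0 := by
  obtain ⟨u, hu, huv⟩ := Input.exists_of_ae_bound (v := (Icc 0 T).indicator v) hC (by
    rw [aestronglyMeasurable_indicator_iff measurableSet_Icc, Measure.restrict_restrict
      measurableSet_Icc, inter_eq_self_of_subset_left Icc_subset_Ici_self]
    exact hv) (by
    rw [ae_restrict_iff' measurableSet_Icc] at hb
    filter_upwards [ae_restrict_of_ae hb] with s hs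
    by_cases hsT : s ∈ Icc 0 T
    · rw [indicator_of_mem hsT]
      exact hs hsT
    · rw [indicator_of_notMem hsT, norm_zero]
      exact hC)
  refine ⟨u, hu, ?_, ?_⟩
  · filter_upwards [ae_Icc_of_ae_Ici huv T, ae_restrict_mem measurableSet_Icc] with s hs hsT
    rw [hs, indicator_of_mem hsT]
  · filter_upwards [huv] with s hs hsT
    rw [hs, indicator_of_notMem hsT]

variable [NormedSpace ℝ X] [NormedSpace ℝ U] {S : ℝ → X →L[ℝ] X} {f : X → U → X}
  {φ : ℝ → X → Input U → X} {η : ℝ≥0 → ℝ≥0}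

omit [NormedSpace ℝ U] in
theorem IsFlow.eqOn (hφ : IsFlow S f φ) {x : X} {u : Input U} {T : ℝ} (hT : 0 < T) {y : ℝ → X}
    (hy : IsMildSolution S (fun s z => f z (u s)) x T y) : EqOn y (fun t => φ t x u) (Icc 0 T) :=
  (hφ x u T hT).2 y hy

omit [NormedSpace ℝ X] in
theorem aestronglyMeasurable_gain_smul (hη : Continuous η) {y : ℝ → X} {v : ℝ → U} {s : Set ℝ}
    (hs : MeasurableSet s) (hy : ContinuousOn y s)
    (hv : AEStronglyMeasurable v (volume.restrict s)) :
    AEStronglyMeasurable (fun r => (η ‖y r‖₊ : ℝ) • v r) (volume.restrict s) := by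
  refine AEStronglyMeasurable.smul ?_ hv
  refine ContinuousOn.aestronglyMeasurable ?_ hs
  exact (NNReal.continuous_coe.comp hη).comp_continuousOn hy.nnnorm

/-- Solutions of the closed-loop system are solutions of the open-loop system for a
trajectory-dominated input. -/
theorem exists_dominatedInput_of_closedLoop (hφ : IsFlow S f φ) (hη : IsClassKInf η) {x : X}
    {d : Input U} (hd : ‖d‖ ≤ 1) {T : ℝ} (hT : 0 < T) {y : ℝ → X}
    (hy : IsMildSolution S (fun s z => f z ((η ‖z‖₊ : ℝ) • d s)) x T y) :
    ∃ u ∈ dominatedInputs φ η x, ∀ t ∈ Icc 0 T, φ t x u = y t := by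
  obtain ⟨R, hR, hyR⟩ := exists_norm_le_of_continuousOn_Icc hy.1
  have hd1 : ∀ᵐ s ∂volume.restrict (Ici (0 : ℝ)), ‖d s‖ ≤ 1 :=
    d.ae_norm_le.mono fun s hs => hs.trans hd
  have hdm : AEStronglyMeasurable d (volume.restrict (Icc (0 : ℝ) T)) :=
    (Lp.aestronglyMeasurable d).mono_measure (Measure.restrict_mono Icc_subset_Ici_self le_rfl)
  have hle : ∀ᵐ s ∂volume.restrict (Icc 0 T), ‖(η ‖y s‖₊ : ℝ) • d s‖ ≤ η ‖y s‖₊ := by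
    filter_upwards [ae_Icc_of_ae_Ici hd1 T] with s hs
    rw [norm_smul, NNReal.norm_eq]
    exact mul_le_of_le_one_right (NNReal.coe_nonneg _) hs
  -- The input is `η(‖y‖) d` on `[0, T]` and zero afterwards. Zero is dominated whatever the
  -- open-loop trajectory does after `T`, and the cut-off keeps `u` essentially bounded.
  obtain ⟨u, -, huT, hu0⟩ := Input.exists_truncation (C := η R.toNNReal) (NNReal.coe_nonneg _)
    (aestronglyMeasurable_gain_smul hη.continuous measurableSet_Icc hy.1 hdm) (by
    filter_upwards [hle, ae_restrict_mem measurableSet_Icc] with s hs hsT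
    refine hs.trans (NNReal.coe_le_coe.2 (hη.strictMono.monotone ?_))
    rw [← NNReal.coe_le_coe, coe_nnnorm, Real.coe_toNNReal _ hR.le]
    exact hyR s hsT)
  have heq : EqOn y (fun t => φ t x u) (Icc 0 T) := by
    refine hφ.eqOn hT (hy.congr (eqOn_refl _ _) ?_)
    filter_upwards [huT] with s hs
    rw [hs]
  refine ⟨u, ?_, fun t ht => (heq ht).symm⟩
  rw [ae_restrict_iff' measurableSet_Icc] at hle huT
  change ∀ᵐ θ ∂(volume.restrict (Ici (0 : ℝ))), ‖u θ‖ ≤ (η ‖φ θ x u‖₊ : ℝ)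
  filter_upwards [hu0, ae_restrict_of_ae hle, ae_restrict_of_ae huT] with s h0 h1 h2
  by_cases hsT : s ∈ Icc 0 T
  · have := heq hsT
    rw [h2 hsT, ← show y s = φ s x u from this]
    exact h1 hsT
  · rw [h0 hsT, norm_zero]
    exact NNReal.coe_nonneg _

/-- Solutions of the open-loop system for trajectory-dominated inputs are solutions of the
closed-loop system. -/
theorem exists_disturbance_of_dominatedInput (hφ : IsFlow S f φ) (hη : IsClassKInf η) {x : X}
    {u : Input U} (hu : u ∈ dominatedInputs φ η x) :
    ∃ d : Input U, ‖d‖ ≤ 1 ∧ ∀ T, 0 < T →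
      IsMildSolution S (fun s z => f z ((η ‖z‖₊ : ℝ) • d s)) x T fun t => φ t x u := by
  have hu : ∀ᵐ θ ∂(volume.restrict (Ici (0 : ℝ))), ‖u θ‖ ≤ (η ‖φ θ x u‖₊ : ℝ) := hu
  have hcont : ContinuousOn (fun t => φ t x u) (Ici 0) := (hφ x u).continuousOn
  have hηm : AEMeasurable (fun s => (η ‖φ s x u‖₊ : ℝ)) (volume.restrict (Ici 0)) :=
    (((NNReal.continuous_coe.comp hη.continuous).comp_continuousOn
      hcont.nnnorm).aestronglyMeasurable measurableSet_Ici).aemeasurable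
  -- Where `η(‖φ‖) = 0`, the convention `0⁻¹ = 0` gives `d = 0`. This is harmless, since domination
  -- makes `u` vanish there too.
  obtain ⟨d, hd, hdu⟩ := Input.exists_of_ae_bound
    (v := fun s => (η ‖φ s x u‖₊ : ℝ)⁻¹ • u s) zero_le_one
    (hηm.inv.aestronglyMeasurable.smul (Lp.aestronglyMeasurable u)) (by
      filter_upwards [hu] with s hs
      rw [norm_smul, norm_inv, NNReal.norm_eq]
      exact inv_mul_le_one_of_le₀ hs (NNReal.coe_nonneg _))
  refine ⟨d, hd, fun T hT => (hφ x u T hT).1.congr (eqOn_refl _ _) ?_⟩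
  filter_upwards [ae_Icc_of_ae_Ici hdu T, ae_Icc_of_ae_Ici hu T] with s hs hs'
  congr 1
  rw [hs]
  rcases eq_or_ne (η ‖φ s x u‖₊ : ℝ) 0 with h | h
  · rw [h, zero_smul]
    rw [h] at hs'
    exact (norm_le_zero_iff.1 hs').symm
  · rw [smul_inv_smul₀ h]

/-- The disturbance extracted from `u₁` is used for both initial values, so the uniform closed-loop
estimate applies. The input `u₂` only has to reproduce the closed-loop trajectory on `[0, τ]`, and
may depend on `τ`. -/
theorem isFlowLipschitzDominated_of_closedLoop (hφ : IsFlow S f φ) (hη : IsClassKInf η)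
    {ψ : ℝ → X → Input U → X} (hψ : IsClosedLoopFlow S f η ψ) (hL : IsFlowLipschitzUniform ψ) :
    IsFlowLipschitzDominated φ := by
  refine ⟨η, hη, fun τ hτ C hC => ?_⟩
  obtain ⟨L, hL0, hL⟩ := hL τ hτ C hC
  refine ⟨L, hL0, fun x₁ x₂ h₁ h₂ u₁ hu₁ => ?_⟩
  obtain ⟨d, hd, hdφ⟩ := exists_disturbance_of_dominatedInput hφ hη hu₁
  obtain ⟨u₂, hu₂, hψu⟩ := exists_dominatedInput_of_closedLoop hφ hη hd hτ (hψ x₂ d hd τ hτ).1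
  refine ⟨u₂, hu₂, fun t ht htτ => ?_⟩
  have h := (hψ x₁ d hd τ hτ).2 _ (hdφ τ hτ) ⟨ht, htτ.le⟩
  rw [hψu t ⟨ht, htτ.le⟩, show φ t x₁ u₁ = ψ t x₁ d from h]
  exact hL x₁ x₂ h₁ h₂ d hd t ht htτ

/-! ### Lipschitz closed loops and their flow -/

omit [NormedSpace ℝ X] in
/-- The closed-loop nonlinearity inherits the Lipschitz constants of condition `(L_η)`. -/
theorem ae_closedLoop_lipschitz {C R K : ℝ} (hRC : R < C)
    (hK : ∀ x₁ x₂ : X, ∀ d : U, ‖x₁‖ < C → ‖x₂‖ < C → ‖d‖ ≤ 1 →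
      ‖f x₁ ((η ‖x₁‖₊ : ℝ) • d) - f x₂ ((η ‖x₂‖₊ : ℝ) • d)‖ ≤ K * ‖x₁ - x₂‖)
    {d : Input U} (hd : ‖d‖ ≤ 1) (T : ℝ) :
    ∀ᵐ s ∂volume.restrict (Icc 0 T), ∀ x y, ‖x‖ ≤ R → ‖y‖ ≤ R →
      ‖f x ((η ‖x‖₊ : ℝ) • d s) - f y ((η ‖y‖₊ : ℝ) • d s)‖ ≤ K * ‖x - y‖ := by
  filter_upwards [ae_Icc_of_ae_Ici d.ae_norm_le T] with s hs x y hx hy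
  exact hK x y _ (hx.trans_lt hRC) (hy.trans_lt hRC) (hs.trans hd)

omit [NormedSpace ℝ X] in
theorem IsClosedLoopLipschitz.isLocallyLipschitzOn (hL : IsClosedLoopLipschitz f η)
    {d : Input U} (hd : ‖d‖ ≤ 1) (T : ℝ) :
    IsLocallyLipschitzOn (fun s z => f z ((η ‖z‖₊ : ℝ) • d s)) T := by
  intro R hR
  obtain ⟨K, hK, hK'⟩ := hL (R + 1) (by positivity)
  exact ⟨K, hK.le, ae_closedLoop_lipschitz (lt_add_one R) hK' hd T⟩

-- Since `η` is 1-Lipschitz with `η 0 = 0`, the feedback `d η(‖x‖)` stays in the ball of radius `C`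
-- and is 1-Lipschitz in `x`. State and input each contribute `L`.
omit [NormedSpace ℝ X] in
theorem isClosedLoopLipschitz_of_jointlyLipschitz (hf : IsJointlyLipschitzOnBounded f)
    (hη : IsClassKInfLipOne η) : IsClosedLoopLipschitz f η := by
  intro C hC
  obtain ⟨L, hL, hLip⟩ := hf C hC
  have hle : ∀ x : X, (η ‖x‖₊ : ℝ) ≤ ‖x‖ := by
    intro x
    have h := hη.2.dist_le_mul ‖x‖₊ 0
    simpa [hη.1.map_zero, NNReal.dist_eq] using h
  have hlt : ∀ (x : X) (d : U), ‖x‖ < C → ‖d‖ ≤ 1 → ‖(η ‖x‖₊ : ℝ) • d‖ < C := by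
    intro x d hx hd
    rw [norm_smul, NNReal.norm_eq]
    exact ((mul_le_of_le_one_right (NNReal.coe_nonneg _) hd).trans (hle x)).trans_lt hx
  refine ⟨L * 2, by positivity, fun x₁ x₂ d h₁ h₂ hd => ?_⟩
  refine (hLip _ _ _ _ h₁ h₂ (hlt _ _ h₁ hd) (hlt _ _ h₂ hd)).trans ?_
  rw [mul_assoc]
  refine mul_le_mul_of_nonneg_left ?_ hL.le
  rw [two_mul, ← sub_smul, norm_smul, Real.norm_eq_abs]
  refine add_le_add_right ?_ _
  refine (mul_le_of_le_one_right (abs_nonneg _) hd).trans ?_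
  have h := hη.2.dist_le_mul ‖x₁‖₊ ‖x₂‖₊
  rw [NNReal.dist_eq, NNReal.dist_eq, NNReal.coe_one, one_mul] at h
  exact h.trans (abs_norm_sub_norm_le _ _)

/-- Closed-loop solutions are open-loop ones under dominated inputs, so robust forward completeness
bounds them uniformly in `d`. This bound gives global existence and a single Lipschitz constant for
Grönwall. -/
theorem exists_closedLoopFlow [CompleteSpace X] (hS : IsC0Semigroup S)
    (hf : ∀ (x : X) (u : Input U),
      AEStronglyMeasurable (fun s => f x (u s)) (volume.restrict (Ici (0 : ℝ))))
    (hφ : IsFlow S f φ) (hη : IsClassKInf η) (hR : IsRFCDominated φ η)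
    (hL : IsClosedLoopLipschitz f η) :
    ∃ ψ : ℝ → X → Input U → X, IsClosedLoopFlow S f η ψ ∧ IsFlowLipschitzUniform ψ := by
  have hbound : ∀ C, 0 < C → ∀ T, 0 < T → ∃ N, ∀ x, ‖x‖ < C → ∀ d : Input U, ‖d‖ ≤ 1 →
      ∀ T' ∈ Ioc 0 T, ∀ y, IsMildSolution S (fun s z => f z ((η ‖z‖₊ : ℝ) • d s)) x T' y →
        ∀ t ∈ Icc 0 T', ‖y t‖ ≤ N := by
    intro C hC T hT
    -- The reachability bound covers only `t < τ`; horizon `T + 1` includes the endpoint `T`.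
    obtain ⟨N, hN⟩ := hR C hC (T + 1) (by positivity)
    refine ⟨N, fun x hx d hd T' hT' y hy t ht => ?_⟩
    obtain ⟨u, hu, hyu⟩ := exists_dominatedInput_of_closedLoop hφ hη hd hT'.1 hy
    rw [← hyu t ht]
    exact hN x hx u hu t ht.1 (by linarith [ht.2, hT'.2])
  have hex : ∀ (x : X) (d : Input U), ‖d‖ ≤ 1 →
      ∃ y, IsUniqueGlobalMildSolution S (fun s z => f z ((η ‖z‖₊ : ℝ) • d s)) x y := by
    intro x d hd
    refine exists_isUniqueGlobalMildSolution hS (fun T _ => hL.isLocallyLipschitzOn hd T)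
      fun T hT => ?_
    obtain ⟨N, hN⟩ := hbound (‖x‖ + 1) (by positivity) T hT
    -- At the origin the feedback vanishes because `η 0 = 0`, so the nonlinearity there is the
    -- constant `f 0 0`.
    refine exists_isMildSolution_of_apriori_bound (B := ‖f 0 0‖) (N := N) hS hT.le (fun z => ?_)
      (hL.isLocallyLipschitzOn hd T) (Eventually.of_forall fun s => ?_) fun T' hT' y hy =>
        hN x (lt_add_one _) d hd T' hT' y hy T' ⟨hT'.1.le, le_rfl⟩
    · refine ((hf z ((η ‖z‖₊ : ℝ) • d)).congr ?_).mono_measure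
        (Measure.restrict_mono Icc_subset_Ici_self le_rfl)
      filter_upwards [Lp.coeFn_smul (η ‖z‖₊ : ℝ) d] with s hs
      rw [hs, Pi.smul_apply]
    · simp [hη.map_zero]
  classical
  choose Y hY using hex
  have hflow : IsClosedLoopFlow S f η fun t x d => if hd : ‖d‖ ≤ 1 then Y x d hd t else 0 := by
    intro x d hd
    simpa only [hd, dite_true] using hY x d hd
  refine ⟨_, hflow, fun τ hτ C hC => ?_⟩
  obtain ⟨N, hN⟩ := hbound C hC τ hτ
  obtain ⟨M, hM1, hM⟩ := hS.exists_norm_le τ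
  obtain ⟨K, hK, hK'⟩ := hL (max N 0 + 1) (by positivity)
  have hM0 : 0 < M := zero_lt_one.trans_le hM1
  refine ⟨M * Real.exp (M * K * τ), by positivity, fun x₁ x₂ h₁ h₂ d hd t ht htτ => ?_⟩
  have s₁ := (hflow x₁ d hd τ hτ).1
  have s₂ := (hflow x₂ d hd τ hτ).1
  have h := IsMildSolution.norm_sub_le hτ.le hK.le hM s₁ s₂
    (fun t ht => (hN x₁ h₁ d hd τ ⟨hτ, le_rfl⟩ _ s₁ t ht).trans (le_max_left _ 0))
    (fun t ht => (hN x₂ h₂ d hd τ ⟨hτ, le_rfl⟩ _ s₂ t ht).trans (le_max_left _ 0))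
    (ae_closedLoop_lipschitz (lt_add_one _) hK' hd τ) t ⟨ht, htτ.le⟩
  refine h.trans ?_
  rw [mul_right_comm]
  gcongr

end

/-! ### A slow gain, and robust forward completeness from bounded reachability sets -/

/-- There are comparison functions growing slower than any given gauge along a sequence of
levels. -/
theorem exists_classKInfLipOne_le {c : ℕ → ℝ≥0} (hc : ∀ n, 1 ≤ c n) :
    ∃ η : ℝ≥0 → ℝ≥0, IsClassKInfLipOne η ∧ ∀ n, η (c n) ≤ n + 1 := by
  -- `η` is the infimum of the lines `n + r / c n`. Slopes at most `1` make it 1-Lipschitz, and the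
  -- `n`-th line has value `n + 1` at `c n`. As the intercepts tend to infinity the infimum is
  -- attained, which gives strict monotonicity.
  let h : ℝ≥0 → ℕ → ℝ≥0 := fun r n => n + r / c n
  have hpos : ∀ n, 0 < c n := fun n => zero_lt_one.trans_le (hc n)
  have hle : ∀ r n, ⨅ k, h r k ≤ h r n := fun r n => ciInf_le (OrderBot.bddBelow _) n
  -- For unboundedness: lines with `n ≥ m` exceed `m` by their intercept, and the finitely many
  -- others do so once `r` is large.
  have hbd : ∀ (m : ℕ) (r : ℝ≥0), (∀ n < m, (m : ℝ≥0) * c n ≤ r) → (m : ℝ≥0) ≤ ⨅ k, h r k := by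
    intro m r hr
    refine le_ciInf fun n => ?_
    rcases lt_or_ge n m with hn | hn
    · exact ((le_div_iff₀ (hpos n)).2 (hr n hn)).trans le_add_self
    · exact (Nat.cast_le.2 hn).trans le_self_add
  have hatt : ∀ r, ∃ n, ⨅ k, h r k = h r n := by
    intro r
    have htend : Tendsto (h r) atTop atTop :=
      tendsto_atTop_mono (fun n => le_self_add) tendsto_natCast_atTop_atTop
    rw [← Nat.cofinite_eq_atTop] at htend
    obtain ⟨n, hn⟩ := htend.exists_forall_le
    exact ⟨n, le_antisymm (hle r n) (le_ciInf hn)⟩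
  have hmono : StrictMono fun r => ⨅ k, h r k := by
    intro r s hrs
    obtain ⟨n, hn⟩ := hatt s
    calc ⨅ k, h r k ≤ h r n := hle r n
      _ < h s n := add_lt_add_right (div_lt_div_of_pos_right hrs (hpos n)) _
      _ = ⨅ k, h s k := hn.symm
  have hlip : LipschitzWith 1 fun r => ⨅ k, h r k := by
    have key : ∀ r s, ⨅ k, h s k ≤ (⨅ k, h r k) + nndist r s := by
      intro r s
      obtain ⟨n, hn⟩ := hatt r
      have h1 : s ≤ r + nndist r s := by
        rw [← NNReal.coe_le_coe, NNReal.coe_add, coe_nndist, NNReal.dist_eq, abs_sub_comm]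
        linarith [le_abs_self ((s : ℝ) - r)]
      rw [hn]
      calc ⨅ k, h s k ≤ n + s / c n := hle s n
        _ ≤ n + (r + nndist r s) / c n := by gcongr
        _ = n + r / c n + nndist r s / c n := by rw [add_div, add_assoc]
        _ ≤ n + r / c n + nndist r s := by gcongr; exact div_le_self bot_le (hc n)
    refine LipschitzWith.of_dist_le_mul fun r s => ?_
    have h1 := NNReal.coe_le_coe.2 (key r s)
    have h2 := NNReal.coe_le_coe.2 (key s r)
    rw [NNReal.coe_add, coe_nndist] at h1 h2
    rw [dist_comm] at h2
    rw [NNReal.dist_eq (⨅ k, h r k), NNReal.coe_one, one_mul, abs_sub_le_iff]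
    constructor <;> linarith
  refine ⟨fun r => ⨅ k, h r k, ⟨⟨?_, hlip.continuous, hmono, ?_⟩, hlip⟩, fun n => ?_⟩
  · exact le_antisymm ((hle 0 0).trans (by simp [h])) bot_le
  · rintro ⟨B, hB⟩
    obtain ⟨m, hm⟩ := exists_nat_gt B
    have h1 := hbd m (∑ n ∈ Finset.range m, m * c n) fun n hn =>
      Finset.single_le_sum (f := fun n => (m : ℝ≥0) * c n) (fun _ _ => bot_le)
        (Finset.mem_range.2 hn)
    exact absurd (hB ⟨_, rfl⟩) (not_le.2 (hm.trans_le h1))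
  · refine (hle _ n).trans (le_of_eq ?_)
    simp only [h]
    rw [div_self (hpos n).ne']

section

variable {X U : Type*} [NormedAddCommGroup X] [NormedSpace ℝ X] [NormedAddCommGroup U]
  [NormedSpace ℝ U] {S : ℝ → X →L[ℝ] X} {f : X → U → X} {φ : ℝ → X → Input U → X}

-- A dominated trajectory cannot climb from below `c k` to `c (k + 1)` before time `k`: until the
-- first hit its input is at most `η (c (k + 1)) < c k`, and bounded reachability then keeps the
-- state strictly below `c (k + 1)`.
omit [NormedSpace ℝ U] in
theorem exists_isRFCDominated (hS : IsC0Semigroup S) (hφ : IsFlow S f φ) (hBRS : HasBRS φ) :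
    ∃ η : ℝ≥0 → ℝ≥0, IsClassKInfLipOne η ∧ IsRFCDominated φ η := by
  have hstep : ∀ (k : ℕ) (c : ℝ≥0), ∃ c' : ℝ≥0, c + 1 ≤ c' ∧
      ∀ (x : X) (u : Input U) (t : ℝ), ‖x‖ < c → ‖u‖ < c → 0 ≤ t → t < k → ‖φ t x u‖ < c' := by
    intro k c
    rcases eq_or_ne c 0 with rfl | hc
    · exact ⟨1, by simp, fun x u t hx => absurd hx (by simp)⟩
    obtain ⟨M, hM⟩ := hBRS c (NNReal.coe_pos.2 (pos_iff_ne_zero.2 hc)) k k.cast_nonneg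
    refine ⟨c + 1 + M.toNNReal, le_self_add, fun x u t h1 h2 h3 h4 => ?_⟩
    refine (hM x u t h1 h2 h3 h4).trans_lt ?_
    push_cast
    have := Real.le_coe_toNNReal M
    have := c.coe_nonneg
    linarith
  choose next hnext1 hnext2 using hstep
  -- Starting at `2` yields `c k ≥ k + 2`, which strictly exceeds the bound `k + 1` on `η (c (k +
  -- 1))`.
  obtain ⟨c, hc0, hc⟩ : ∃ c : ℕ → ℝ≥0, c 0 = 2 ∧ ∀ k, c (k + 1) = next k (c k) :=
    ⟨fun k => Nat.rec 2 next k, rfl, fun _ => rfl⟩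
  have hck : ∀ k : ℕ, (k : ℝ≥0) + 2 ≤ c k := by
    intro k
    induction k with
    | zero => simp [hc0]
    | succ k ih =>
      rw [hc]
      refine le_trans ?_ (hnext1 k (c k))
      push_cast
      rw [add_right_comm]
      gcongr
  obtain ⟨η, hη, hηc⟩ := exists_classKInfLipOne_le (c := fun k => c (k + 1)) fun k =>
    le_trans (by norm_num) (le_add_self.trans (hck (k + 1)))
  have hηlt : ∀ k, η (c (k + 1)) < c k := fun k =>
    (hηc k).trans_lt ((add_lt_add_right (by norm_num) _).trans_le (hck k))
  refine ⟨η, hη, fun C hC τ hτ => ?_⟩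
  obtain ⟨k, hk⟩ := exists_nat_gt (max C τ)
  have hkc : (k : ℝ) + 2 ≤ (c k : ℝ) := by exact_mod_cast hck k
  have hcc : (c k : ℝ) + 1 ≤ c (k + 1) := by exact_mod_cast hc k ▸ hnext1 k (c k)
  refine ⟨c (k + 1), fun x hx u hu t ht htτ => ?_⟩
  have hxk : ‖x‖ < (c k : ℝ) := by linarith [le_max_left C τ]
  by_contra! hlt
  have hcont : ContinuousOn (fun t => φ t x u) (Ici 0) := (hφ x u).continuousOn
  obtain ⟨T, hT, hTeq, hTle⟩ := exists_first_hitting_time ht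
    ((hcont.mono Icc_subset_Ici_self).norm) (R := c (k + 1)) (by
      rw [show φ 0 x u = x from (hφ x u).apply_zero hS]
      linarith) hlt.le
  have hu : ∀ᵐ θ ∂(volume.restrict (Ici (0 : ℝ))), ‖u θ‖ ≤ (η ‖φ θ x u‖₊ : ℝ) := hu
  -- The smallness of `u` is known only up to the hitting time `T`. Truncation makes it a bound on
  -- the full norm, and by uniqueness leaves the trajectory on `[0, T]` unchanged.
  obtain ⟨v, hvn, hvu, -⟩ := Input.exists_truncation (v := u) (T := T) (C := η (c (k + 1)))
    (NNReal.coe_nonneg _) ((Lp.aestronglyMeasurable u).mono_measure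
      (Measure.restrict_mono Icc_subset_Ici_self le_rfl)) (by
      filter_upwards [ae_Icc_of_ae_Ici hu T, ae_restrict_mem measurableSet_Icc] with s hs hsT
      refine hs.trans (NNReal.coe_le_coe.2 (hη.1.strictMono.monotone ?_))
      exact hTle s hsT)
  have heq := hφ.eqOn (u := v) hT.1 (((hφ x u T hT.1).1).congr (eqOn_refl _ _) (by
    filter_upwards [hvu] with s hs
    rw [hs])) ⟨hT.1.le, le_rfl⟩
  have h1 := hnext2 k (c k) x v T hxk (hvn.trans_lt (NNReal.coe_lt_coe.2 (hηlt k))) hT.1.le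
    (by linarith [hT.2, le_max_right C τ])
  rw [← show φ T x u = φ T x v from heq, hTeq, hc] at h1
  exact lt_irrefl _ h1

end

end BRS

theorem mainTheorem3 {X U : Type*} [NormedAddCommGroup X] [NormedSpace ℝ X] [CompleteSpace X]
    [NormedAddCommGroup U] [NormedSpace ℝ U]
    (A : X →ₗ.[ℝ] X) (S : ℝ → X →L[ℝ] X) (hS : BRS.IsC0Semigroup S) (hA : BRS.IsGenerator A S)
    (f : X → U → X)
    (hf : ∀ (x : X) (u : BRS.Input U),
      AEStronglyMeasurable (fun s => f x (u s)) (volume.restrict (Ici (0 : ℝ))))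
    (φ : ℝ → X → BRS.Input U → X) (hφ : BRS.IsFlow S f φ) (hBRS : BRS.HasBRS φ) :
    -- (1) ⇒ (2)
    (BRS.IsJointlyLipschitzOnBounded f →
      ∀ η : ℝ≥0 → ℝ≥0, BRS.IsClassKInfLipOne η → BRS.IsClosedLoopLipschitz f η) ∧
    -- (2) ⇒ (3)
    ((∀ η : ℝ≥0 → ℝ≥0, BRS.IsClassKInfLipOne η → BRS.IsClosedLoopLipschitz f η) →
      ∃ η : ℝ≥0 → ℝ≥0, BRS.IsClassKInfLipOne η ∧
        BRS.IsRFCDominated φ η ∧ BRS.IsClosedLoopLipschitz f η) ∧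
    -- (3) ⇒ (4)
    ((∃ η : ℝ≥0 → ℝ≥0, BRS.IsClassKInfLipOne η ∧
        BRS.IsRFCDominated φ η ∧ BRS.IsClosedLoopLipschitz f η) →
      ∃ η : ℝ≥0 → ℝ≥0, BRS.IsClassKInfLipOne η ∧
        ∃ ψ : ℝ → X → BRS.Input U → X,
          BRS.IsClosedLoopFlow S f η ψ ∧ BRS.IsFlowLipschitzUniform ψ) ∧
    -- (4) ⇒ (5)
    ((∃ η : ℝ≥0 → ℝ≥0, BRS.IsClassKInfLipOne η ∧
        ∃ ψ : ℝ → X → BRS.Input U → X,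
          BRS.IsClosedLoopFlow S f η ψ ∧ BRS.IsFlowLipschitzUniform ψ) →
      BRS.IsFlowLipschitzDominated φ) := by
  refine ⟨fun h η hη => BRS.isClosedLoopLipschitz_of_jointlyLipschitz h hη, fun h => ?_, ?_, ?_⟩
  · obtain ⟨η, hη, hR⟩ := BRS.exists_isRFCDominated hS hφ hBRS
    exact ⟨η, hη, hR, h η hη⟩
  · rintro ⟨η, hη, hR, hL⟩
    exact ⟨η, hη, BRS.exists_closedLoopFlow hS hf hφ hη.1 hR hL⟩
  · rintro ⟨η, hη, ψ, hψ, hL⟩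
    exact BRS.isFlowLipschitzDominated_of_closedLoop hφ hη.1 hψ hL
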